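/- Let $k$ be a field and let $\Lambda$ be a finite dimensional selfinjective $k$-algebra on which a finite group $G$ acts by $k$-algebra automorphisms, and suppose that the order of $G$ is invertible in $k$. Let $\Lambda[G]$ be the skew group algebra, i.e. the vector space $\Lambda\otimes_k kG$ with multiplication $(\lambda\otimes g)(\lambda'\otimes g')=\lambda\, g(\lambda')\otimes gg'$. For a finite dimensional algebra $A$ let $\operatorname{mod} A$ be the category of finitely generated left $A$-modules; a module in $\operatorname{mod} A$ is a generator (respectively a cogenerator) if every indecomposable projective (respectively injective) module in $\operatorname{mod} A$ is isomorphic to a direct summand of it. The representation dimension of $A$ is $$\operatorname{repdim} A=\inf\{\operatorname{gldim}\operatorname{End}_A(N)\mid N\in\operatorname{mod}A \text{ is a generator and a cogenerator}\},$$ where $\operatorname{gldim}$ denotes global dimension. Let $M$ be a generator in $\operatorname{mod}\Lambda$. For $g\in G$ let ${}_gM$ be $M$ with the scalar multiplication $\lambda\cdot m=g(\lambda)m$, and suppose that $\bigoplus_{g\in G}{}_gM$ belongs to $\operatorname{add}_\Lambda M$, i.e. is isomorphic to a direct summand of a finite direct sum of copies of $M$. Then $$\operatorname{repdim}\Lambda[G]\le\operatorname{gldim}\operatorname{End}_\Lambda(M).$$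 -/

import Mathlib

universe u v w

open scoped DirectSum

/-- The (left) global dimension of a ring: the supremum of the projective dimensions of its left
modules. It takes values in `WithBot ℕ∞`; the value `⊥` occurs only for the zero ring. -/
noncomputable def globalDim (R : Type u) [Ring R] : WithBot ℕ∞ :=
  ⨆ N : ModuleCat.{u} R, CategoryTheory.projectiveDimension N

/-- `X` is isomorphic to a direct summand of `Y`. -/
def IsSummandOf (R : Type u) [Ring R] (X : Type v) [AddCommGroup X] [Module R X]
    (Y : Type w) [AddCommGroup Y] [Module R Y] : Prop :=
  ∃ (i : X →ₗ[R] Y) (p : Y →ₗ[R] X), p ∘ₗ i = LinearMap.id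

/-- `X` belongs to `add M`: it is isomorphic to a direct summand of a finite direct sum of copies
of `M`. -/
def MemAdd (R : Type u) [Ring R] (M : Type v) [AddCommGroup M] [Module R M]
    (X : Type w) [AddCommGroup X] [Module R X] : Prop :=
  ∃ n : ℕ, IsSummandOf R X (Fin n → M)

/-- A nonzero module that is not the direct sum of two nonzero submodules. -/
def IsIndecomposableModule (R : Type u) [Ring R] (X : Type v) [AddCommGroup X] [Module R X] :
    Prop :=
  Nontrivial X ∧ ∀ p q : Submodule R X, IsCompl p q → p = ⊥ ∨ q = ⊥

/-- `M` is a generator of `mod R`: every finitely generated indecomposable projective module is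
isomorphic to a direct summand of `M`. -/
def GeneratesMod (R : Type u) [Ring R] (M : Type v) [AddCommGroup M] [Module R M] : Prop :=
  ∀ P : ModuleCat.{u} R, Module.Finite R P → Module.Projective R P →
    IsIndecomposableModule R P → IsSummandOf R P M

/-- `M` is a cogenerator of `mod R`: every finitely generated indecomposable injective module is
isomorphic to a direct summand of `M`. -/
def CogeneratesMod (R : Type u) [Ring R] (M : Type v) [AddCommGroup M] [Module R M] : Prop :=
  ∀ I : ModuleCat.{u} R, Module.Finite R I → Module.Injective R I →
    IsIndecomposableModule R I → IsSummandOf R I M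

/-- The representation dimension: the infimum of the global dimensions of `End_R(M)`, over all
finitely generated modules `M` that generate and cogenerate `mod R`. -/
noncomputable def repDim (R : Type u) [Ring R] : WithBot ℕ∞ :=
  sInf {d | ∃ M : ModuleCat.{u} R, Module.Finite R M ∧ GeneratesMod R M ∧ CogeneratesMod R M ∧
    d = globalDim (Module.End R M)}

/-- The underlying additive group of the twisted module `_g M`. -/
def TwistedModule {G : Type u} (_g : G) (M : Type v) : Type v := M

instance {G : Type u} (g : G) (M : Type v) [AddCommGroup M] : AddCommGroup (TwistedModule g M) :=
  inferInstanceAs (AddCommGroup M)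

/-- The module `_g M`: the group `M` with scalar multiplication `a · m = g(a) m`. -/
instance {G : Type u} [Group G] (g : G) (A : Type w) [Ring A] [MulSemiringAction G A]
    (M : Type v) [AddCommGroup M] [Module A M] : Module A (TwistedModule g M) :=
  Module.compHom M (MulSemiringAction.toRingHom G A g)

/-! Write Γ for Λ[G], N for `Coinduced G M` (over Λ, the product of the twists of M), A for End_Λ(M)
and B for End_Γ(N). The bound follows because N competes in the infimum defining repdim Γ and gldim
B ≤ gldim A.

N is a generator because |G| is invertible: by averaging, every Γ-module is a summand of the module
coinduced from its restriction to Λ (`isSummandOf_coinduced`), so summands of Λ coinduce to enough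
projectives. Averaging also makes Γ selfinjective. Over an artinian selfinjective ring the finitely
generated indecomposable injectives are projective
(`IsIndecomposableModule.projective_of_injective`), so N is a cogenerator too.

For the inequality, B is graded by G with identity component A. Since N lies in add M over Λ, B is
projective over A, and 1 is a sum of products of elements of degrees g⁻¹ and g, for every g.
Averaging these expressions over G gives a separability idempotent (`Coinduced.hasAveraging_end`),
and then projective dimension over B is at most that over A (`HasAveraging.globalDim_le`). -/

section FiniteLength

/-! ### Modules of finite length, and injectives over selfinjective rings -/

variable {R : Type u} [Ring R]

theorem IsSummandOf.trans {X : Type*} [AddCommGroup X] [Module R X] {Y : Type*} [AddCommGroup Y]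
    [Module R Y] {Z : Type*} [AddCommGroup Z] [Module R Z]
    (h : IsSummandOf R X Y) (h' : IsSummandOf R Y Z) : IsSummandOf R X Z := by
  obtain ⟨i, p, hp⟩ := h
  obtain ⟨j, q, hq⟩ := h'
  refine ⟨j ∘ₗ i, p ∘ₗ q, LinearMap.ext fun x => ?_⟩
  have h1 : q (j (i x)) = i x := LinearMap.congr_fun hq (i x)
  have h2 : p (i x) = x := LinearMap.congr_fun hp x
  simp [h1, h2]

theorem LinearEquiv.isSummandOf {X : Type*} [AddCommGroup X] [Module R X] {Y : Type*}
    [AddCommGroup Y] [Module R Y] (e : X ≃ₗ[R] Y) : IsSummandOf R X Y :=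
  ⟨e, e.symm, LinearMap.ext fun x => by simp⟩

theorem IsSummandOf.injective {X Y : Type u} [AddCommGroup X] [Module R X] [AddCommGroup Y]
    [Module R Y] (h : IsSummandOf R X Y) (hY : Module.Injective R Y) : Module.Injective R X := by
  obtain ⟨i, p, hp⟩ := h
  refine ⟨fun A B _ _ _ _ f hf g => ?_⟩
  obtain ⟨e, he⟩ := hY.out f hf (i ∘ₗ g)
  exact ⟨p ∘ₗ e, fun x => by simpa [he x] using LinearMap.congr_fun hp (g x)⟩

theorem IsSummandOf.projective {X : Type v} {Y : Type w} [AddCommGroup X] [Module R X]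
    [AddCommGroup Y] [Module R Y] (h : IsSummandOf R X Y) (hY : Module.Projective R Y) :
    Module.Projective R X :=
  let ⟨i, p, hp⟩ := h
  Module.Projective.of_split i p hp

theorem IsSummandOf.finite {X : Type v} {Y : Type w} [AddCommGroup X] [Module R X]
    [AddCommGroup Y] [Module R Y] (h : IsSummandOf R X Y) (hY : Module.Finite R Y) :
    Module.Finite R X :=
  let ⟨i, p, hp⟩ := h
  Module.Finite.of_surjective p fun x => ⟨i x, LinearMap.congr_fun hp x⟩

/-- Fitting's dichotomy. -/
theorem IsIndecomposableModule.isNilpotent_or_isUnit {X : Type*} [AddCommGroup X] [Module R X]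
    [IsArtinian R X] [IsNoetherian R X] (hX : IsIndecomposableModule R X) (f : Module.End R X) :
    IsNilpotent f ∨ IsUnit f := by
  obtain ⟨n, hn, hn0⟩ :=
    (f.eventually_isCompl_ker_pow_range_pow.and (Filter.eventually_ge_atTop 1)).exists
  rcases hX.2 _ _ hn with h | h
  · right
    have hinj : Function.Injective f := by
      rw [← LinearMap.ker_eq_bot, eq_bot_iff, ← h]
      intro x hx
      obtain ⟨m, rfl⟩ := Nat.exists_eq_add_of_le' hn0
      rw [LinearMap.mem_ker] at hx ⊢
      rw [pow_succ, Module.End.mul_apply, hx, map_zero]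
    exact (Module.End.isUnit_iff f).2 (IsArtinian.bijective_of_injective_endomorphism f hinj)
  · exact Or.inl ⟨n, LinearMap.range_eq_bot.1 h⟩

/-- By Fitting a non-unit is nilpotent, and 1 minus a nilpotent is a unit: the endomorphism ring is
local. -/
theorem IsIndecomposableModule.exists_isUnit_of_isUnit_sum {X : Type*} [AddCommGroup X]
    [Module R X] [IsArtinian R X] [IsNoetherian R X] (hX : IsIndecomposableModule R X)
    {ι : Type*} (s : Finset ι) (f : ι → Module.End R X) (hf : IsUnit (∑ i ∈ s, f i)) :
    ∃ i ∈ s, IsUnit (f i) := by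
  classical
  have := hX.1
  induction s using Finset.induction_on with
  | empty => simp at hf
  | insert a s ha ih =>
    rw [Finset.sum_insert ha] at hf
    obtain ⟨c, hc⟩ := hf
    rcases hX.isNilpotent_or_isUnit (↑c⁻¹ * f a) with h | h
    · have h1 := h.isUnit_one_sub
      have h2 : 1 - ↑c⁻¹ * f a = ↑c⁻¹ * ∑ i ∈ s, f i := by
        rw [sub_eq_iff_eq_add, ← mul_add, add_comm, ← hc, Units.inv_mul]
      rw [h2, Units.isUnit_units_mul] at h1
      obtain ⟨i, hi, hu⟩ := ih h1
      exact ⟨i, Finset.mem_insert_of_mem hi, hu⟩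
    · exact ⟨a, Finset.mem_insert_self _ _, (Units.isUnit_units_mul _ _).1 h⟩

/-- The identity of X is the sum of its factorizations through the Y i, so one of these is
invertible. This replaces Krull–Schmidt throughout. -/
theorem IsIndecomposableModule.exists_isSummandOf_of_pi {X : Type*} [AddCommGroup X]
    [Module R X] [IsArtinian R X] [IsNoetherian R X] (hX : IsIndecomposableModule R X)
    {ι : Type*} [Finite ι] {Y : ι → Type*} [∀ i, AddCommGroup (Y i)] [∀ i, Module R (Y i)]
    (h : IsSummandOf R X (∀ i, Y i)) : ∃ i, IsSummandOf R X (Y i) := by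
  classical
  have := Fintype.ofFinite ι
  obtain ⟨a, p, hp⟩ := h
  let f : ι → Module.End R X := fun i =>
    (p ∘ₗ LinearMap.single R Y i) ∘ₗ (LinearMap.proj i ∘ₗ a)
  have hsum : ∑ i, f i = 1 := by
    ext x
    have : ∑ i, Pi.single i (a x i) = a x := Finset.univ_sum_single (a x)
    simpa [f, ← map_sum, this] using LinearMap.congr_fun hp x
  obtain ⟨i, -, c, hc⟩ := hX.exists_isUnit_of_isUnit_sum Finset.univ f (hsum ▸ isUnit_one)
  refine ⟨i, LinearMap.proj i ∘ₗ a, (↑c⁻¹ : Module.End R X) ∘ₗ (p ∘ₗ LinearMap.single R Y i), ?_⟩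
  rw [LinearMap.comp_assoc]
  change (↑c⁻¹ : Module.End R X) * f i = 1
  rw [← hc, Units.inv_mul]

/-- A module of finite length is a finite direct sum of indecomposable summands. -/
theorem exists_indecomposable_summands (X : Type u) [AddCommGroup X] [Module R X]
    [IsArtinian R X] : ∃ (ι : Type) (_ : Finite ι) (Q : ι → ModuleCat.{u} R),
      (∀ i, IsIndecomposableModule R (Q i) ∧ IsSummandOf R (Q i) X) ∧
        IsSummandOf R X (∀ i, Q i) := by
  suffices H : ∀ p : Submodule R X, ∃ (ι : Type) (_ : Finite ι) (Q : ι → ModuleCat.{u} R),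
      (∀ i, IsIndecomposableModule R (Q i) ∧ IsSummandOf R (Q i) p) ∧
        IsSummandOf R p (∀ i, Q i) by
    obtain ⟨ι, hι, Q, hQ, hX⟩ := H ⊤
    exact ⟨ι, hι, Q, fun i => ⟨(hQ i).1, (hQ i).2.trans Submodule.topEquiv.isSummandOf⟩,
      Submodule.topEquiv.symm.isSummandOf.trans hX⟩
  intro p
  induction p using WellFoundedLT.induction with
  | ind p ih =>
  by_cases hp : IsIndecomposableModule R p
  · exact ⟨Unit, inferInstance, fun _ => ModuleCat.of R p,
      fun _ => ⟨hp, (LinearEquiv.refl R p).isSummandOf⟩,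
      (LinearEquiv.funUnique Unit R p).symm.isSummandOf⟩
  rcases subsingleton_or_nontrivial p with hs | hs
  · exact ⟨Empty, inferInstance, fun e => e.elim, fun e => e.elim, 0, 0, Subsingleton.elim _ _⟩
  have : ∃ a b : Submodule R p, IsCompl a b ∧ a ≠ ⊥ ∧ b ≠ ⊥ := by
    by_contra! hcon
    exact hp ⟨hs, fun a b hab => or_iff_not_imp_left.2 (hcon a b hab)⟩
  obtain ⟨a, b, hab, ha, hb⟩ := this
  have hlt : ∀ a b : Submodule R p, IsCompl a b → b ≠ ⊥ → a.map p.subtype < p := by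
    intro a b hab hb
    refine lt_of_le_of_ne (Submodule.map_subtype_le p a) fun h => hb ?_
    have ha : a = ⊤ := by
      apply Submodule.map_injective_of_injective p.injective_subtype
      rw [h, Submodule.map_subtype_top]
    rw [ha] at hab
    exact top_disjoint.1 hab.disjoint
  have hdec : ∀ a : Submodule R p, a.map p.subtype < p →
      ∃ (ι : Type) (_ : Finite ι) (Q : ι → ModuleCat.{u} R),
        (∀ i, IsIndecomposableModule R (Q i) ∧ IsSummandOf R (Q i) a) ∧
          IsSummandOf R a (∀ i, Q i) := by
    intro a ha
    obtain ⟨ι, hι, Q, hQ, hX⟩ := ih _ ha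
    have e := Submodule.equivMapOfInjective p.subtype p.injective_subtype a
    exact ⟨ι, hι, Q, fun i => ⟨(hQ i).1, (hQ i).2.trans e.symm.isSummandOf⟩,
      e.isSummandOf.trans hX⟩
  obtain ⟨ι, hι, Q, hQ, i₁, p₁, h₁⟩ := hdec a (hlt a b hab hb)
  obtain ⟨κ, hκ, T, hT, i₂, p₂, h₂⟩ := hdec b (hlt b a hab.symm ha)
  have e := Submodule.prodEquivOfIsCompl a b hab
  refine ⟨ι ⊕ κ, inferInstance, Sum.elim Q T, ?_, ?_⟩
  · rintro (i | i)
    · exact ⟨(hQ i).1, (hQ i).2.trans (IsSummandOf.trans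
        ⟨LinearMap.inl R a b, LinearMap.fst R a b, rfl⟩ e.isSummandOf)⟩
    · exact ⟨(hT i).1, (hT i).2.trans (IsSummandOf.trans
        ⟨LinearMap.inr R a b, LinearMap.snd R a b, rfl⟩ e.isSummandOf)⟩
  · refine e.symm.isSummandOf.trans ⟨LinearMap.pi (Sum.rec
      (fun i => LinearMap.proj i ∘ₗ i₁ ∘ₗ LinearMap.fst R a b)
      (fun i => LinearMap.proj i ∘ₗ i₂ ∘ₗ LinearMap.snd R a b)), LinearMap.prod
      (p₁ ∘ₗ LinearMap.pi fun i => LinearMap.proj (Sum.inl i))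
      (p₂ ∘ₗ LinearMap.pi fun i => LinearMap.proj (Sum.inr i)), ?_⟩
    refine LinearMap.ext fun x => Prod.ext ?_ ?_
    · exact LinearMap.congr_fun h₁ x.1
    · exact LinearMap.congr_fun h₂ x.2

/-- Indecomposable injective modules of finite length that share a simple submodule are
isomorphic. -/
theorem IsIndecomposableModule.nonempty_linearEquiv_of_injective {X Y S : Type u}
    [AddCommGroup X] [Module R X] [AddCommGroup Y] [Module R Y] [AddCommGroup S] [Module R S]
    [IsArtinian R X] [IsNoetherian R X] [IsArtinian R Y] [IsNoetherian R Y] [Nontrivial S]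
    (hX : IsIndecomposableModule R X) (hY : IsIndecomposableModule R Y)
    (hXi : Module.Injective R X) (hYi : Module.Injective R Y)
    (i : S →ₗ[R] X) (hi : Function.Injective i) (j : S →ₗ[R] Y) (hj : Function.Injective j) :
    Nonempty (X ≃ₗ[R] Y) := by
  obtain ⟨s, hs⟩ := exists_ne (0 : S)
  -- An endomorphism fixing a nonzero element is not nilpotent, hence bijective. Injectivity
  -- supplies maps both ways whose composites fix the image of s.
  have key : ∀ {X : Type u} [AddCommGroup X] [Module R X] [IsArtinian R X] [IsNoetherian R X]
      (_ : IsIndecomposableModule R X) (i : S →ₗ[R] X) (_ : Function.Injective i)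
      (f : Module.End R X), f (i s) = i s → Function.Bijective f := by
    intro X _ _ _ _ hX i hi f hf
    rcases hX.isNilpotent_or_isUnit f with ⟨n, hn⟩ | h
    · have hfix : ∀ n, (f ^ n) (i s) = i s := fun n => by
        induction n with
        | zero => rfl
        | succ n ih => rw [pow_succ, Module.End.mul_apply, hf, ih]
      have := hfix n
      rw [hn, LinearMap.zero_apply, eq_comm, map_eq_zero_iff i hi] at this
      exact absurd this hs
    · exact (Module.End.isUnit_iff f).1 h
  obtain ⟨f, hf⟩ := hYi.out i hi j
  obtain ⟨g, hg⟩ := hXi.out j hj i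
  have h1 := key hX i hi (g ∘ₗ f) (by simp [hf, hg])
  have h2 := key hY j hj (f ∘ₗ g) (by simp [hf, hg])
  exact ⟨LinearEquiv.ofBijective f ⟨Function.Injective.of_comp (f := g) h1.1,
    Function.Surjective.of_comp (g := g) h2.2⟩⟩

/-- An indecomposable projective module of finite length has only one simple quotient. -/
theorem IsIndecomposableModule.nonempty_linearEquiv_of_projective {P : Type*} {S T : Type*}
    [AddCommGroup P] [Module R P] [AddCommGroup S] [Module R S] [AddCommGroup T] [Module R T]
    [IsArtinian R P] [IsNoetherian R P] [IsSimpleModule R S] [IsSimpleModule R T]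
    (hP : IsIndecomposableModule R P) (hPp : Module.Projective R P)
    (f : P →ₗ[R] S) (hf : f ≠ 0) (g : P →ₗ[R] T) (hg : g ≠ 0) : Nonempty (S ≃ₗ[R] T) := by
  have hfs := LinearMap.surjective_of_ne_zero hf
  have hgs := LinearMap.surjective_of_ne_zero hg
  have hcf := LinearMap.isCoatom_ker_of_surjective hfs
  have hcg := LinearMap.isCoatom_ker_of_surjective hgs
  by_cases hk : LinearMap.ker f = LinearMap.ker g
  · exact ⟨(f.quotKerEquivOfSurjective hfs).symm ≪≫ₗ
      Submodule.quotEquivOfEq _ _ hk ≪≫ₗ g.quotKerEquivOfSurjective hgs⟩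
  exfalso
  have hne : f.domRestrict (LinearMap.ker g) ≠ 0 := by
    intro h0
    refine hk ((hcg.le_iff_eq hcf.1).1 fun x hx => ?_)
    exact LinearMap.congr_fun h0 ⟨x, hx⟩
  -- As f stays onto on ker g, it lifts to an endomorphism e with f e = f and g e = 0; the first
  -- forbids nilpotent, the second forbids unit.
  obtain ⟨h, hh⟩ := Module.projective_lifting_property _ f (LinearMap.surjective_of_ne_zero hne)
  let e : Module.End R P := (LinearMap.ker g).subtype ∘ₗ h
  have hfe : ∀ x, f (e x) = f x := fun x => LinearMap.congr_fun hh x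
  have hge : ∀ x, g (e x) = 0 := fun x => (h x).2
  rcases hP.isNilpotent_or_isUnit e with ⟨n, hn⟩ | hu
  · have hfix : ∀ n x, f ((e ^ n) x) = f x := fun n => by
      induction n with
      | zero => simp
      | succ n ih => intro x; rw [pow_succ, Module.End.mul_apply, ih, hfe]
    exact hf (LinearMap.ext fun x => by rw [← hfix n x, hn]; simp)
  · refine hg (LinearMap.ext fun x => ?_)
    obtain ⟨y, rfl⟩ := ((Module.End.isUnit_iff e).1 hu).2 x
    exact hge y

/-- Over a left artinian left selfinjective ring, finitely generated indecomposable injective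
modules are projective. -/
theorem IsIndecomposableModule.projective_of_injective [IsArtinianRing R]
    (hR : Module.Injective R R) {I : Type u} [AddCommGroup I] [Module R I] [Module.Finite R I]
    (hI : IsIndecomposableModule R I) (hIi : Module.Injective R I) : Module.Projective R I := by
  classical
  obtain ⟨ι, hι, Q, hQ, a, p, hp⟩ := exists_indecomposable_summands (R := R) R
  have := Fintype.ofFinite ι
  have hfin : ∀ i, Module.Finite R (Q i) := fun i => (hQ i).2.finite inferInstance
  have hproj : ∀ i, Module.Projective R (Q i) := fun i => (hQ i).2.projective inferInstance
  have hinj : ∀ i, Module.Injective R (Q i) := fun i => (hQ i).2.injective hR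
  have simple_sub : ∀ (X : Type u) [AddCommGroup X] [Module R X] [IsArtinian R X] [Nontrivial X],
      ∃ S : Submodule R X, IsSimpleModule R S := by
    intro X _ _ _ _
    obtain ⟨S, hS, -⟩ := (eq_bot_or_exists_atom_le (⊤ : Submodule R X)).resolve_left top_ne_bot
    exact ⟨S, isSimpleModule_iff_isAtom.2 hS⟩
  have cover : ∀ (S : Type u) [AddCommGroup S] [Module R S] [IsSimpleModule R S],
      ∃ (i : ι) (f : Q i →ₗ[R] S), f ≠ 0 := by
    intro S _ _ _
    by_contra! hcon
    have := IsSimpleModule.nontrivial R S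
    obtain ⟨s, hs⟩ := exists_ne (0 : S)
    refine hs ?_
    have hz : LinearMap.toSpanSingleton R S s ∘ₗ p = 0 :=
      LinearMap.pi_ext' fun i => by rw [LinearMap.zero_comp]; exact hcon i _
    have h1 := LinearMap.congr_fun hz (a 1)
    have h2 : p (a 1) = 1 := LinearMap.congr_fun hp 1
    simpa [h2] using h1
  have hnt : ∀ i, Nontrivial (Q i) := fun i => (hQ i).1.1
  -- The Nakayama permutation: σ sends Q i to a summand covering a simple submodule of Q i. Once it
  -- is onto on isomorphism classes, every simple module embeds in some Q i.
  choose S hS using fun i => simple_sub (Q i)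
  choose σ f hf using fun i => cover (S i)
  let r : Setoid ι :=
    { r := fun i j => Nonempty (Q i ≃ₗ[R] Q j)
      iseqv := ⟨fun i => ⟨.refl R _⟩, fun ⟨e⟩ => ⟨e.symm⟩, fun ⟨e⟩ ⟨e'⟩ => ⟨e.trans e'⟩⟩ }
  -- The chosen cover of the socle depends injectively on the isomorphism class.
  have hσ : ∀ i j, Nonempty (Q (σ i) ≃ₗ[R] Q (σ j)) → Nonempty (Q i ≃ₗ[R] Q j) := by
    rintro i j ⟨e⟩
    have hne : f j ∘ₗ e.toLinearMap ≠ 0 := fun h => hf j <| LinearMap.ext fun x => by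
      simpa using LinearMap.congr_fun h (e.symm x)
    obtain ⟨t⟩ := (hQ (σ i)).1.nonempty_linearEquiv_of_projective (hproj _) (f i) (hf i) _ hne
    have := IsSimpleModule.nontrivial R (S i)
    exact (hQ i).1.nonempty_linearEquiv_of_injective (hQ j).1 (hinj i) (hinj j)
      (S i).subtype (S i).injective_subtype ((S j).subtype ∘ₗ t.toLinearMap)
      ((S j).injective_subtype.comp t.injective)
  let τ : Quotient r → Quotient r := fun c => Quotient.mk r (σ c.out)
  have hτ : Function.Surjective τ := by
    refine Finite.surjective_of_injective fun c d hcd => ?_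
    rw [← c.out_eq, ← d.out_eq]
    exact Quotient.sound (hσ _ _ (Quotient.exact hcd))
  have := hI.1
  -- A simple submodule T of I is also the chosen simple submodule of some Q, so I is isomorphic to
  -- that projective Q.
  obtain ⟨T, hT⟩ := simple_sub I
  obtain ⟨j, g, hg⟩ := cover T
  obtain ⟨c, hc⟩ := hτ (Quotient.mk r j)
  obtain ⟨e⟩ : Nonempty (Q (σ c.out) ≃ₗ[R] Q j) := Quotient.exact hc
  have hne : g ∘ₗ e.toLinearMap ≠ 0 := fun h => hg <| LinearMap.ext fun x => by
    simpa using LinearMap.congr_fun h (e.symm x)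
  obtain ⟨t⟩ := (hQ _).1.nonempty_linearEquiv_of_projective (hproj _) (f c.out) (hf _) _ hne
  have := IsSimpleModule.nontrivial R (S c.out)
  obtain ⟨e'⟩ := (hQ c.out).1.nonempty_linearEquiv_of_injective hI (hinj _) hIi
    (S c.out).subtype (S c.out).injective_subtype (T.subtype ∘ₗ t.toLinearMap)
    (T.injective_subtype.comp t.injective)
  exact Module.Projective.of_equiv e'

end FiniteLength

/-! ### Separability idempotents and global dimension -/

section Averaging

/-- `B` has a separability idempotent over `A`, given as `∑ uᵢ ⊗ vᵢ`: averaging an `A`-linear map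
`f` between `B`-modules to `∑ uᵢ f(vᵢ ·)` makes it `B`-linear. -/
def HasAveraging (A B : Type u) [Ring A] [Ring B] [Module A B] : Prop :=
  ∃ (n : ℕ) (a b : Fin n → B), ∑ i, a i * b i = 1 ∧
    ∀ (Y Z : Type u) [AddCommGroup Y] [AddCommGroup Z] [Module A Y] [Module A Z] [Module B Y]
      [Module B Z] [IsScalarTower A B Y] [IsScalarTower A B Z] (f : Y →ₗ[A] Z) (c : B) (y : Y),
      ∑ i, a i • f (b i • c • y) = c • ∑ i, a i • f (b i • y)

variable {A B : Type u} [Ring A] [Ring B] [Module A B]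

theorem HasAveraging.of_sum_eq_natCast {ι : Type*} [Fintype ι] (a b : ι → B) (n : ℕ)
    (hn : IsUnit (n : B)) (hab : ∑ i, a i * b i = n)
    (h : ∀ (Y Z : Type u) [AddCommGroup Y] [AddCommGroup Z] [Module A Y] [Module A Z] [Module B Y]
      [Module B Z] [IsScalarTower A B Y] [IsScalarTower A B Z] (f : Y →ₗ[A] Z) (c : B) (y : Y),
      ∑ i, a i • f (b i • c • y) = c • ∑ i, a i • f (b i • y)) : HasAveraging A B := by
  obtain ⟨e, he⟩ := hn
  let t := (Fintype.equivFin ι).symm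
  refine ⟨Fintype.card ι, fun i => ↑e⁻¹ * a (t i), fun i => b (t i), ?_, ?_⟩
  · simp_rw [mul_assoc]
    rw [← Finset.mul_sum, t.sum_comp fun i => a i * b i, hab, ← he, Units.inv_mul]
  · intro Y Z _ _ _ _ _ _ _ _ f c y
    have hc : Commute (↑e⁻¹ : B) c := Commute.units_inv_left (he ▸ Nat.cast_commute n c)
    simp_rw [mul_smul]
    rw [← Finset.smul_sum, ← Finset.smul_sum, t.sum_comp fun i => a i • f (b i • c • y),
      t.sum_comp fun i => a i • f (b i • y), h, ← mul_smul, ← mul_smul, hc.eq]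

/-- Averaging leaves a B-linear composite t f s unchanged, since ∑ aᵢ bᵢ = 1. Allowing s and t
covers sections, extensions and retractions at once. -/
theorem HasAveraging.exists_linearMap (hAB : HasAveraging A B) {Y Z : Type u} [AddCommGroup Y]
    [AddCommGroup Z] [Module A Y] [Module A Z] [Module B Y] [Module B Z] [IsScalarTower A B Y]
    [IsScalarTower A B Z] (f : Y →ₗ[A] Z) :
    ∃ F : Y →ₗ[B] Z, ∀ {X W : Type u} [AddCommGroup X] [AddCommGroup W] [Module B X] [Module B W]
      (s : X →ₗ[B] Y) (t : Z →ₗ[B] W) (g : X →ₗ[B] W), (∀ x, t (f (s x)) = g x) →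
        ∀ x, t (F (s x)) = g x := by
  obtain ⟨m, a, b, h1, h⟩ := hAB
  refine ⟨{ toFun := fun y => ∑ i, a i • f (b i • y)
            map_add' := fun x y => by simp [Finset.sum_add_distrib]
            map_smul' := fun c y => h Y Z f c y }, ?_⟩
  intro X W _ _ _ _ s t g hg x
  simp only [LinearMap.coe_mk, AddHom.coe_mk, map_sum, map_smul]
  simp_rw [← map_smul s, hg, map_smul, ← mul_smul]
  rw [← Finset.sum_smul, h1, one_smul]

theorem HasAveraging.projective (hAB : HasAveraging A B) {Y : Type u} [AddCommGroup Y]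
    [Module A Y] [Module B Y] [IsScalarTower A B Y] [IsScalarTower A B B]
    (hY : Module.Projective A Y) : Module.Projective B Y := by
  let q : (Y →₀ B) →ₗ[B] Y := Finsupp.linearCombination B id
  have hq : Function.Surjective q := fun y => ⟨Finsupp.single y 1, by simp [q]⟩
  obtain ⟨f, hf⟩ := Module.projective_lifting_property (q.restrictScalars A) LinearMap.id hq
  obtain ⟨F, hF⟩ := hAB.exists_linearMap f
  exact Module.Projective.of_split F q (LinearMap.ext
    (hF LinearMap.id q LinearMap.id fun x => LinearMap.congr_fun hf x))

theorem HasAveraging.injective (hAB : HasAveraging A B) [IsScalarTower A B B] {Y : Type u}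
    [AddCommGroup Y] [Module A Y] [Module B Y] [IsScalarTower A B Y]
    (hY : Module.Injective A Y) : Module.Injective B Y := by
  refine ⟨fun X Z _ _ _ _ i hi g => ?_⟩
  let _ : Module A X := Module.compHom X (RingHom.smulOneHom : A →+* B)
  let _ : Module A Z := Module.compHom Z (RingHom.smulOneHom : A →+* B)
  have : IsScalarTower A B X := ⟨fun a b x => by
    change (a • b) • x = ((a • 1 : B)) • b • x
    rw [← mul_smul, smul_mul_assoc, one_mul]⟩
  have : IsScalarTower A B Z := ⟨fun a b x => by
    change (a • b) • x = ((a • 1 : B)) • b • x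
    rw [← mul_smul, smul_mul_assoc, one_mul]⟩
  obtain ⟨f, hf⟩ := hY.out (i.restrictScalars A) hi (g.restrictScalars A)
  obtain ⟨F, hF⟩ := hAB.exists_linearMap f
  exact ⟨F, hF i LinearMap.id g hf⟩

theorem Module.Projective.restrict [IsScalarTower A B B] (hB : Module.Projective A B) {Y : Type*}
    [AddCommGroup Y] [Module A Y] [Module B Y] [IsScalarTower A B Y]
    (hY : Module.Projective B Y) : Module.Projective A Y := by
  classical
  obtain ⟨s, hs⟩ := hY.out
  have : Module.Projective A (Y →₀ B) :=
    Module.Projective.of_equiv (finsuppLequivDFinsupp (ι := Y) (M := B) A).symm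
  exact Module.Projective.of_split (s.restrictScalars A)
    ((Finsupp.linearCombination B id).restrictScalars A) (LinearMap.ext hs)

-- Dimension shifting along a free B-cover, which is projective over A as well; its kernel serves as
-- syzygy over both rings.
open CategoryTheory in
theorem HasAveraging.hasProjectiveDimensionLT (hAB : HasAveraging A B) [IsScalarTower A B B]
    (hB : Module.Projective A B) (n : ℕ) (Y : Type u) [AddCommGroup Y] [Module A Y] [Module B Y]
    [IsScalarTower A B Y] (hY : HasProjectiveDimensionLT (ModuleCat.of A Y) n) :
    HasProjectiveDimensionLT (ModuleCat.of B Y) n := by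
  -- Dimension below 0 means the zero module; the induction starts at dimension below 1, that is, at
  -- projective modules.
  obtain _ | n := n
  · rw [hasProjectiveDimensionLT_zero_iff_isZero, ModuleCat.isZero_iff_subsingleton] at hY ⊢
    exact hY
  induction n generalizing Y with
  | zero =>
    rw [zero_add, ← projective_iff_hasProjectiveDimensionLT_one,
      ← IsProjective.iff_projective] at hY ⊢
    exact hAB.projective hY
  | succ n ih =>
    let q : (Y →₀ B) →ₗ[B] Y := Finsupp.linearCombination B id
    have hq : Function.Surjective q := fun y => ⟨Finsupp.single y 1, by simp [q]⟩
    have hA : Projective (ModuleCat.of A (Y →₀ B)) :=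
      (IsProjective.iff_projective _).1 (Module.Projective.restrict hB
        (inferInstance : Module.Projective B (Y →₀ B)))
    have hB : Projective (ModuleCat.of B (Y →₀ B)) :=
      (IsProjective.iff_projective _).1 inferInstance
    have hSA := LinearMap.shortExact_shortComplexKer (f := q.restrictScalars A) hq
    have hSB := LinearMap.shortExact_shortComplexKer (f := q) hq
    refine (hSB.hasProjectiveDimensionLT_X₃_iff n hB).2 (ih (LinearMap.ker q) ?_)
    have := (hSA.hasProjectiveDimensionLT_X₃_iff n hA).1 hY
    let e : LinearMap.ker (q.restrictScalars A) ≃ₗ[A] LinearMap.ker q :=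
      { toFun := fun x => ⟨x.1, x.2⟩
        invFun := fun x => ⟨x.1, x.2⟩
        map_add' := fun _ _ => rfl
        map_smul' := fun _ _ => rfl
        left_inv := fun _ => rfl
        right_inv := fun _ => rfl }
    have iso : ModuleCat.of A (LinearMap.ker (q.restrictScalars A)) ≅
        ModuleCat.of A (LinearMap.ker q) := e.toModuleIso
    exact hasProjectiveDimensionLT_of_iso iso _

theorem HasAveraging.globalDim_le (hAB : HasAveraging A B) [IsScalarTower A B B]
    (hB : Module.Projective A B) : globalDim B ≤ globalDim A := by
  refine iSup_le fun Y => ?_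
  let _ : Module A Y := Module.compHom Y (RingHom.smulOneHom : A →+* B)
  have : IsScalarTower A B Y := ⟨fun a b x => by
    change (a • b) • x = ((a • 1 : B)) • b • x
    rw [← mul_smul, smul_mul_assoc, one_mul]⟩
  refine le_trans ?_ (le_iSup _ (ModuleCat.of A Y))
  exact sInf_le_sInf fun d hd i hi => hAB.hasProjectiveDimensionLT hB i Y (hd i hi)

end Averaging

/-! ### Coinduction from Λ to the skew group algebra -/

noncomputable section

/-- The underlying group of the module coinduced from `M` to the skew group algebra. -/
def Coinduced (G : Type v) (M : Type w) : Type (max v w) := G → M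

namespace Coinduced

open SkewMonoidAlgebra

variable {Λ : Type u} [Ring Λ] {G : Type u} [Group G] [MulSemiringAction G Λ]
  {M : Type u} [AddCommGroup M] [Module Λ M]

instance : AddCommGroup (Coinduced G M) := inferInstanceAs (AddCommGroup (G → M))

/-- As a `Λ`-module, the coinduced module is the product of the twisted modules. -/
instance : Module Λ (Coinduced G M) := inferInstanceAs (Module Λ (∀ g : G, TwistedModule g M))

theorem smul_apply (a : Λ) (x : Coinduced G M) (g : G) : (a • x) g = (g • a) • x g := rfl

theorem add_apply {G M : Type u} [AddCommGroup M] (x y : Coinduced G M) (g : G) :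
    (x + y) g = x g + y g := rfl

theorem sum_apply {G M : Type u} [AddCommGroup M] {ι : Type*} (s : Finset ι) (x : ι → Coinduced G M) (g : G) :
    (∑ i ∈ s, x i) g = ∑ i ∈ s, x i g :=
  Finset.sum_apply g s x

variable (Λ G M) in
/-- The action of the skew group algebra on the coinduced module. -/
def toEnd : SkewMonoidAlgebra Λ G →+* AddMonoid.End (Coinduced G M) :=
  liftNCRingHom (Module.toAddMonoidEnd Λ (Coinduced G M))
    { toFun := fun h =>
        { toFun := fun x g => x (g * h)
          map_zero' := rfl
          map_add' := fun _ _ => rfl }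
      map_one' := by ext x; funext g; exact congrArg x (mul_one g)
      map_mul' := fun h h' => by ext x; funext g; exact congrArg x (mul_assoc g h h').symm }
    (by
      intro a h
      ext x
      funext g
      change (g • h • a) • x (g * h) = ((g * h) • a) • x (g * h)
      rw [mul_smul])

instance : Module (SkewMonoidAlgebra Λ G) (Coinduced G M) :=
  Module.compHom (Coinduced G M) (toEnd Λ G M)

theorem single_smul_apply (h : G) (a : Λ) (x : Coinduced G M) (g : G) :
    (single h a • x) g = (g • a) • x (g * h) := by
  change (toEnd Λ G M (single h a) x) g = _
  simp [toEnd, liftNCRingHom]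
  rfl

theorem single_one_smul_apply (h : G) (x : Coinduced G M) (g : G) :
    ((single h 1 : SkewMonoidAlgebra Λ G) • x) g = x (g * h) := by
  rw [single_smul_apply, smul_one, one_smul]

instance : IsScalarTower Λ (SkewMonoidAlgebra Λ G) (Coinduced G M) := ⟨fun a b x => by
  induction b using SkewMonoidAlgebra.induction_on with
  | zero => simp
  | add b c hb hc => rw [smul_add, add_smul, hb, hc, add_smul, smul_add]
  | single h b =>
    funext g
    rw [smul_single, single_smul_apply, smul_apply, single_smul_apply, smul_eq_mul, smul_mul',
      mul_smul]⟩

variable (Λ G M) in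
/-- Evaluation at the identity of `G`. -/
def eval : Coinduced G M →ₗ[Λ] M where
  toFun x := x 1
  map_add' _ _ := rfl
  map_smul' a x := by rw [smul_apply, one_smul, RingHom.id_apply]

section Lift

variable {Y : Type*} [AddCommGroup Y] [Module Λ Y] [Module (SkewMonoidAlgebra Λ G) Y]
  [IsScalarTower Λ (SkewMonoidAlgebra Λ G) Y]

variable (G) in
/-- The additive map underlying `Coinduced.lift`. -/
def liftAddHom (f : Y →+ M) : Y →+ Coinduced G M where
  toFun y g := f ((single g 1 : SkewMonoidAlgebra Λ G) • y)
  map_zero' := funext fun g => by rw [smul_zero, map_zero]; rfl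
  map_add' x y := funext fun g => by rw [smul_add, map_add]; rfl

/-- The map into the coinduced module that corresponds to a `Λ`-linear map. -/
def lift (f : Y →ₗ[Λ] M) : Y →ₗ[SkewMonoidAlgebra Λ G] Coinduced G M where
  __ := liftAddHom (Λ := Λ) G f.toAddMonoidHom
  map_smul' b y := by
    change liftAddHom (Λ := Λ) G f.toAddMonoidHom (b • y) =
      b • liftAddHom (Λ := Λ) G f.toAddMonoidHom y
    induction b using SkewMonoidAlgebra.induction_on with
    | zero => rw [zero_smul, zero_smul, map_zero]
    | add b c hb hc => rw [add_smul, add_smul, map_add, hb, hc]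
    | single h b =>
      funext g
      rw [single_smul_apply]
      change f ((single g 1 : SkewMonoidAlgebra Λ G) • single h b • y) =
        (g • b) • f ((single (g * h) 1 : SkewMonoidAlgebra Λ G) • y)
      rw [← map_smul, ← smul_assoc (g • b), ← mul_smul, single_mul_single, smul_single, one_mul,
        smul_eq_mul, mul_one]

theorem eval_lift (f : Y →ₗ[Λ] M) (y : Y) : eval Λ G M (lift f y) = f y := by
  change f _ = _
  rw [single_one_one, one_smul]

theorem lift_apply_one (f : Y →ₗ[Λ] M) (y : Y) : (lift f y : Coinduced G M) 1 = f y :=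
  eval_lift f y

/-- With `eval_lift`, this is the adjunction between restriction and coinduction: the coordinate at
g is the coordinate at 1 after acting by g. -/
theorem lift_eval (f : Y →ₗ[SkewMonoidAlgebra Λ G] Coinduced G M) :
    lift (eval Λ G M ∘ₗ f.restrictScalars Λ) = f := by
  ext y
  funext g
  change f ((single g 1 : SkewMonoidAlgebra Λ G) • y) 1 = _
  rw [map_smul, single_one_smul_apply, one_mul]

theorem hom_ext {f f' : Y →ₗ[SkewMonoidAlgebra Λ G] Coinduced G M}
    (h : ∀ y, f y 1 = f' y 1) : f = f' := by
  rw [← lift_eval f, ← lift_eval f']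
  congr 1
  exact LinearMap.ext h

end Lift

variable {M' : Type u} [AddCommGroup M'] [Module Λ M']

variable (G) in
/-- Functoriality of coinduction. -/
def map (f : M →ₗ[Λ] M') : Coinduced G M →ₗ[SkewMonoidAlgebra Λ G] Coinduced G M' :=
  lift (f ∘ₗ eval Λ G M)

theorem map_apply (f : M →ₗ[Λ] M') (x : Coinduced G M) (g : G) : map G f x g = f (x g) := by
  change f (((single g 1 : SkewMonoidAlgebra Λ G) • x) 1) = _
  rw [single_one_smul_apply, one_mul]

end Coinduced

open Coinduced in
theorem IsSummandOf.coinduced {Λ : Type u} [Ring Λ] (G : Type u) [Group G] [MulSemiringAction G Λ]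
    {M M' : Type u} [AddCommGroup M] [Module Λ M] [AddCommGroup M'] [Module Λ M']
    (h : IsSummandOf Λ M M') :
    IsSummandOf (SkewMonoidAlgebra Λ G) (Coinduced G M) (Coinduced G M') := by
  obtain ⟨i, p, hp⟩ := h
  refine ⟨Coinduced.map G i, Coinduced.map G p, LinearMap.ext fun x => funext fun g => ?_⟩
  rw [LinearMap.comp_apply, map_apply, map_apply]
  exact LinearMap.congr_fun hp (x g)

open Coinduced in
theorem IsSummandOf.coinduced_pi {Λ : Type u} [Ring Λ] (G : Type u) [Group G]
    [MulSemiringAction G Λ] {M : Type u} [AddCommGroup M] [Module Λ M] {ι : Type*}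
    {Q : ι → Type u} [∀ i, AddCommGroup (Q i)] [∀ i, Module Λ (Q i)]
    (h : IsSummandOf Λ M (∀ i, Q i)) :
    IsSummandOf (SkewMonoidAlgebra Λ G) (Coinduced G M) (∀ i, Coinduced G (Q i)) := by
  obtain ⟨i, p, hp⟩ := h
  refine ⟨LinearMap.pi fun j => Coinduced.map G (LinearMap.proj j ∘ₗ i),
    Coinduced.lift (p ∘ₗ LinearMap.pi fun j => eval Λ G (Q j) ∘ₗ LinearMap.proj j),
    hom_ext fun x => ?_⟩
  rw [LinearMap.comp_apply, lift_apply_one, LinearMap.comp_apply]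
  refine (congrArg p (funext fun j => ?_)).trans (LinearMap.congr_fun hp (x 1))
  exact map_apply (LinearMap.proj j ∘ₗ i) x 1

end

/-! ### Averaging over Λ[G] and over the graded endomorphism ring -/

noncomputable section

-- Maschke's element |G|⁻¹ ∑ g⁻¹ ⊗ g: scalars of Λ pass through f, and right multiplication by h
-- permutes the terms.
open SkewMonoidAlgebra in
theorem SkewMonoidAlgebra.hasAveraging {Λ : Type u} [Ring Λ] {G : Type u} [Group G] [Finite G]
    [MulSemiringAction G Λ] (hn : IsUnit (Nat.card G : Λ)) :
    HasAveraging Λ (SkewMonoidAlgebra Λ G) := by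
  have := Fintype.ofFinite G
  have hn' : IsUnit ((Nat.card G : ℕ) : SkewMonoidAlgebra Λ G) := by
    simpa using hn.map (singleOneRingHom (k := Λ) (G := G))
  refine HasAveraging.of_sum_eq_natCast (fun g : G => single g⁻¹ 1) (fun g : G => single g 1)
    (Nat.card G) hn' ?_ ?_
  · simp [single_mul_single, Nat.card_eq_fintype_card]
  intro Y Z _ _ _ _ _ _ _ _ f c y
  induction c using SkewMonoidAlgebra.induction_on with
  | zero => simp
  | add b c hb hc => simp [add_smul, smul_add, Finset.sum_add_distrib, hb, hc]
  | single h a =>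
    have h1 : ∀ g : G, (single g 1 : SkewMonoidAlgebra Λ G) • single h a • y =
        (g • a) • (single (g * h) 1 : SkewMonoidAlgebra Λ G) • y := fun g => by
      rw [← smul_assoc (g • a), ← mul_smul, single_mul_single, smul_single, one_mul, smul_eq_mul,
        mul_one]
    have h2 : ∀ (g : G) (z : Z), (single g⁻¹ 1 : SkewMonoidAlgebra Λ G) • (g • a) • z =
        (single h a : SkewMonoidAlgebra Λ G) •
          (single (g * h)⁻¹ 1 : SkewMonoidAlgebra Λ G) • z := fun g z => by
      rw [← one_smul (SkewMonoidAlgebra Λ G) z, ← smul_assoc (g • a), ← mul_smul, ← mul_smul,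
        ← mul_smul, one_def, smul_single, single_mul_single, single_mul_single, mul_one,
        single_mul_single]
      simp
    simp_rw [h1, map_smul, h2]
    rw [← Finset.smul_sum]
    congr 1
    exact Fintype.sum_equiv (Equiv.mulRight h) _ _ fun g => rfl

namespace Coinduced

open SkewMonoidAlgebra

variable {Λ : Type u} [Ring Λ] {G : Type u} [Group G] [MulSemiringAction G Λ]
  {M : Type u} [AddCommGroup M] [Module Λ M]

variable (Λ G M) in
/-- Coinduction as a homomorphism of endomorphism rings. -/
def mapRingHom : Module.End Λ M →+* Module.End (SkewMonoidAlgebra Λ G) (Coinduced G M) where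
  toFun f := map G f
  map_one' := hom_ext fun x => map_apply _ _ _
  map_mul' f f' := hom_ext fun x => by
    rw [Module.End.mul_apply, map_apply, map_apply, map_apply, Module.End.mul_apply]
  map_zero' := hom_ext fun x => map_apply _ _ _
  map_add' f f' := hom_ext fun x => by
    rw [map_apply]
    change _ = map G f x 1 + map G f' x 1
    rw [map_apply, map_apply, LinearMap.add_apply]

instance : Module (Module.End Λ M) (Module.End (SkewMonoidAlgebra Λ G) (Coinduced G M)) :=
  Module.compHom _ (mapRingHom Λ G M)

theorem end_smul_def (a : Module.End Λ M)
    (b : Module.End (SkewMonoidAlgebra Λ G) (Coinduced G M)) : a • b = map G a * b := rfl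

instance : IsScalarTower (Module.End Λ M) (Module.End (SkewMonoidAlgebra Λ G) (Coinduced G M))
    (Module.End (SkewMonoidAlgebra Λ G) (Coinduced G M)) := ⟨fun a b c => mul_assoc (map G a) b c⟩

/-- By adjunction B is Hom_Λ(N, M), a summand of Hom_Λ(Mⁿ, M) = Aⁿ. -/
theorem projective_end {n : ℕ} (h : IsSummandOf Λ (Coinduced G M) (Fin n → M)) :
    Module.Projective (Module.End Λ M)
      (Module.End (SkewMonoidAlgebra Λ G) (Coinduced G M)) := by
  obtain ⟨i, p, hp⟩ := h
  let s : Module.End (SkewMonoidAlgebra Λ G) (Coinduced G M) →ₗ[Module.End Λ M]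
      (Fin n → Module.End Λ M) :=
    { toFun := fun b j => eval Λ G M ∘ₗ b.restrictScalars Λ ∘ₗ p ∘ₗ LinearMap.single Λ (fun _ => M) j
      map_add' := fun _ _ => rfl
      map_smul' := fun a b => funext fun j => LinearMap.ext fun m => map_apply a _ 1 }
  let t : (Fin n → Module.End Λ M) →ₗ[Module.End Λ M]
      Module.End (SkewMonoidAlgebra Λ G) (Coinduced G M) :=
    { toFun := fun c => lift (∑ j, c j ∘ₗ LinearMap.proj j ∘ₗ i)
      map_add' := fun c d => hom_ext fun x => by
        rw [LinearMap.add_apply, add_apply, lift_apply_one, lift_apply_one, lift_apply_one]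
        simp [Finset.sum_add_distrib]
      map_smul' := fun a c => hom_ext fun x => by
        rw [RingHom.id_apply, end_smul_def, Module.End.mul_apply, map_apply]
        rw [lift_apply_one, lift_apply_one]
        simp }
  refine Module.Projective.of_split s t (LinearMap.ext fun b => hom_ext fun x => ?_)
  change eval Λ G M (lift _ x) = eval Λ G M (b x)
  rw [eval_lift]
  have h1 : ∑ j, Pi.single j (i x j) = i x := Finset.univ_sum_single (i x)
  have h2 : p (i x) = x := LinearMap.congr_fun hp x
  calc _ = ∑ j, eval Λ G M (b (p (Pi.single j (i x j)))) := LinearMap.sum_apply _ _ _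
    _ = eval Λ G M (b (p (∑ j, Pi.single j (i x j)))) := by simp only [_root_.map_sum]
    _ = _ := by rw [h1, h2]

/-- The endomorphisms of degree `g` of the coinduced module: those for which the value at `h` of
the image of `x` depends only on the value of `x` at `g * h`. -/
def IsHomogeneous (g : G) (b : Module.End (SkewMonoidAlgebra Λ G) (Coinduced G M)) : Prop :=
  ∀ x h, x (g * h) = 0 → b x h = 0

/-- Degrees multiply in reverse order, because the degree multiplies the argument on the left. -/
theorem IsHomogeneous.mul {g h : G}
    {b c : Module.End (SkewMonoidAlgebra Λ G) (Coinduced G M)}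
    (hb : IsHomogeneous g b) (hc : IsHomogeneous h c) : IsHomogeneous (h * g) (b * c) :=
  fun x k hx => hb _ _ (hc _ _ (by rwa [← mul_assoc]))

theorem isHomogeneous_lift {g : G} {f : Coinduced G M →ₗ[Λ] M}
    (hf : ∀ x : Coinduced G M, x g = 0 → f x = 0) : IsHomogeneous g (lift f) :=
  fun x h hx => hf _ (by rwa [single_one_smul_apply])

open Classical in
variable (Λ M) in
/-- The projection of the coinduced module onto its component at `g`. -/
def component (g : G) : Coinduced G M →ₗ[Λ] Coinduced G M where
  toFun x h := if h = g then x h else 0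
  map_add' x y := funext fun h => by
    change ite _ (x h + y h) _ = (if h = g then x h else 0) + (if h = g then y h else 0)
    split_ifs <;> simp
  map_smul' a x := funext fun h => by
    change ite _ ((h • a) • x h) _ = (h • a) • (if h = g then x h else 0)
    split_ifs <;> simp

open Classical in
theorem component_apply (g h : G) (x : Coinduced G M) :
    component Λ M g x h = if h = g then x h else 0 := rfl

theorem component_congr {g : G} {x y : Coinduced G M} (h : x g = y g) :
    component Λ M g x = component Λ M g y := funext fun k => by
  rw [component_apply, component_apply]
  split_ifs with hk
  · rw [hk, h]
  · rfl

theorem component_eq_zero {g : G} {x : Coinduced G M} (h : x g = 0) :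
    component Λ M g x = 0 :=
  (component_congr (y := 0) h).trans (map_zero _)

theorem sum_component [Fintype G] (x : Coinduced G M) : ∑ g, component Λ M g x = x := by
  classical
  funext h
  rw [sum_apply]
  simp [component_apply]

open Classical in
variable (Λ G M) in
/-- The inclusion of `M` as the component at the identity. -/
def incl : M →ₗ[Λ] Coinduced G M where
  toFun m h := if h = 1 then m else 0
  map_add' x y := funext fun h => by
    change _ = (if h = 1 then x else 0) + (if h = 1 then y else 0)
    split_ifs <;> simp
  map_smul' a x := funext fun h => by
    change _ = (h • a) • (if h = 1 then x else 0)
    split_ifs with hh <;> simp [hh]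

theorem incl_apply_one (m : M) : incl Λ G M m 1 = m := if_pos rfl

theorem IsHomogeneous.congr {g : G} {b : Module.End (SkewMonoidAlgebra Λ G) (Coinduced G M)}
    (hb : IsHomogeneous g b) {x y : Coinduced G M} {h : G} (hxy : x (g * h) = y (g * h)) :
    b x h = b y h := by
  have h1 := hb (x - y) h (sub_eq_zero.2 hxy)
  rw [map_sub] at h1
  exact sub_eq_zero.1 h1

/-- Such a b acts coordinatewise, and Γ-linearity makes its action at 1 determine the rest. -/
theorem IsHomogeneous.exists_eq_smul_one
    {b : Module.End (SkewMonoidAlgebra Λ G) (Coinduced G M)} (hb : IsHomogeneous 1 b) :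
    ∃ a : Module.End Λ M, b = a • 1 := by
  refine ⟨eval Λ G M ∘ₗ b.restrictScalars Λ ∘ₗ incl Λ G M, hom_ext fun x => ?_⟩
  rw [end_smul_def, mul_one, map_apply]
  exact hb.congr (by rw [mul_one, incl_apply_one])

theorem exists_sum_isHomogeneous [Fintype G]
    (b : Module.End (SkewMonoidAlgebra Λ G) (Coinduced G M)) :
    ∃ c : G → Module.End (SkewMonoidAlgebra Λ G) (Coinduced G M),
      (∀ g, IsHomogeneous g (c g)) ∧ ∑ g, c g = b := by
  refine ⟨fun g => lift (eval Λ G M ∘ₗ b.restrictScalars Λ ∘ₗ component Λ M g), fun g =>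
    isHomogeneous_lift fun x hx => ?_, hom_ext fun x => ?_⟩
  · simp [component_eq_zero hx]
  · rw [LinearMap.sum_apply, sum_apply]
    simp only [lift_apply_one, LinearMap.comp_apply, LinearMap.restrictScalars_apply]
    rw [← _root_.map_sum, ← _root_.map_sum, sum_component]
    rfl

/-- The strongly graded analogue of Maschke's element: in place of g⁻¹ ⊗ g stands ∑ⱼ a g j ⊗ b g j,
of degrees g⁻¹ and g. -/
theorem hasAveraging_end [Finite G] (hn : IsUnit (Nat.card G : Λ)) {n : ℕ}
    (h : IsSummandOf Λ (Coinduced G M) (Fin n → M)) :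
    HasAveraging (Module.End Λ M) (Module.End (SkewMonoidAlgebra Λ G) (Coinduced G M)) := by
  have := Fintype.ofFinite G
  obtain ⟨i, p, hp⟩ := h
  -- The splitting of N off Mⁿ, cut down to coordinate g. Placing p at g⁻¹ cancels the twist, which
  -- makes q linear over Λ.
  let q (g : G) (j : Fin n) : Coinduced G M →ₗ[Λ] M :=
    { toFun := fun x => p (Pi.single j (x g⁻¹)) g
      map_add' := fun x y => by
        change p (Pi.single j (x g⁻¹ + y g⁻¹)) g = _
        rw [Pi.single_add, map_add]
        rfl
      map_smul' := fun a x => by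
        rw [smul_apply, Pi.single_smul, map_smul, smul_apply, smul_inv_smul, RingHom.id_apply] }
  let a (g : G) (j : Fin n) : Module.End (SkewMonoidAlgebra Λ G) (Coinduced G M) := lift (q g j)
  let b (g : G) (j : Fin n) : Module.End (SkewMonoidAlgebra Λ G) (Coinduced G M) :=
    lift (LinearMap.proj j ∘ₗ i ∘ₗ component Λ M g)
  have ha : ∀ g j, IsHomogeneous g⁻¹ (a g j) := fun g j => isHomogeneous_lift fun x hx => by
    change p (Pi.single j (x g⁻¹)) g = 0
    rw [hx, Pi.single_zero, map_zero]
    rfl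
  have hb : ∀ g j, IsHomogeneous g (b g j) := fun g j => isHomogeneous_lift fun x hx => by
    simp [component_eq_zero hx]
  have hab : ∀ g, ∑ j, a g j * b g j = 1 := by
    intro g
    refine hom_ext fun x => ?_
    let y : Coinduced G M := component Λ M g ((single g⁻¹ 1 : SkewMonoidAlgebra Λ G) • x)
    have h1 : ∑ j, Pi.single j (i y j) = i y := Finset.univ_sum_single (i y)
    have h2 : p (i y) = y := LinearMap.congr_fun hp y
    have h3 : y g = x 1 := by
      change component Λ M g _ g = _
      rw [component_apply, if_pos rfl, single_one_smul_apply, mul_inv_cancel]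
    have h4 : ∀ j, (a g j * b g j) x 1 = p (Pi.single j (i y j)) g :=
      fun j => lift_apply_one (q g j) (b g j x)
    rw [LinearMap.sum_apply, sum_apply, Finset.sum_congr rfl fun j _ => h4 j, ← sum_apply,
      ← _root_.map_sum, h1, h2, h3]
    rfl
  have hn' : IsUnit ((Nat.card G : ℕ) :
      Module.End (SkewMonoidAlgebra Λ G) (Coinduced G M)) := by
    have hu : IsUnit ((Nat.card G : ℕ) : SkewMonoidAlgebra Λ G) := by
      simpa using hn.map (singleOneRingHom (k := Λ) (G := G))
    rw [Module.End.isUnit_iff]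
    convert (hu.smul_bijective (β := Coinduced G M)) using 1
    funext x
    simp [Nat.cast_smul_eq_nsmul]
  refine HasAveraging.of_sum_eq_natCast (fun t : G × Fin n => a t.1 t.2) (fun t => b t.1 t.2)
    (Nat.card G) hn' (by simp [Fintype.sum_prod_type, hab]) ?_
  intro Y Z _ _ _ _ _ _ _ _ f c y
  have key : ∀ (h : G) (c : Module.End (SkewMonoidAlgebra Λ G) (Coinduced G M)),
      IsHomogeneous h c → ∀ g, ∑ j, a g j • f (b g j • c • y) =
        c • ∑ j, a (h * g) j • f (b (h * g) j • y) := by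
    intro h c hc g
    -- The total degree is 1, so these products come from A and pass through the A-linear f.
    -- Inserting ∑ₗ a b = 1 at h * g, and then removing ∑ⱼ a b = 1 at g, moves c to the left.
    have hd : ∀ j l, ∃ d : Module.End Λ M, b g j * c * a (h * g) l = d • 1 := fun j l =>
      IsHomogeneous.exists_eq_smul_one (by simpa using ((hb g j).mul hc).mul (ha (h * g) l))
    choose d hd using hd
    have hs : ∀ (W : Type u) [AddCommGroup W] [Module (Module.End Λ M) W]
        [Module (Module.End (SkewMonoidAlgebra Λ G) (Coinduced G M)) W]
        [IsScalarTower (Module.End Λ M)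
          (Module.End (SkewMonoidAlgebra Λ G) (Coinduced G M)) W] (j l) (w : W),
        (b g j * c * a (h * g) l) • w = d j l • w := fun W _ _ _ _ j l w => by
      rw [hd, smul_assoc, one_smul]
    have h1 : ∀ j, b g j • c • y = ∑ l, d j l • b (h * g) l • y := fun j => by
      simp_rw [← hs, ← mul_smul]
      rw [← Finset.sum_smul]
      simp_rw [mul_assoc]
      rw [← Finset.mul_sum, ← Finset.mul_sum, hab, mul_one]
    simp_rw [h1, _root_.map_sum, map_smul, ← hs, Finset.smul_sum, ← mul_smul]
    rw [Finset.sum_comm]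
    refine Finset.sum_congr rfl fun l _ => ?_
    rw [← Finset.sum_smul]
    simp_rw [mul_assoc]
    simp_rw [← mul_assoc (a g _) (b g _)]
    rw [← Finset.sum_mul, hab, one_mul]
  obtain ⟨c, hc, rfl⟩ := exists_sum_isHomogeneous c
  have h1 : ∑ t : G × Fin n, a t.1 t.2 • f (b t.1 t.2 • (∑ h, c h) • y) =
      ∑ h, ∑ t : G × Fin n, a t.1 t.2 • f (b t.1 t.2 • c h • y) := by
    rw [Finset.sum_comm]
    simp_rw [Finset.sum_smul, Finset.smul_sum, _root_.map_sum, Finset.smul_sum]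
  rw [h1, Finset.sum_smul]
  refine Finset.sum_congr rfl fun h _ => ?_
  rw [Fintype.sum_prod_type, Fintype.sum_prod_type]
  simp_rw [key h (c h) (hc h)]
  rw [← Finset.smul_sum]
  congr 1
  exact Equiv.sum_comp (Equiv.mulLeft h) fun g => ∑ j, a g j • f (b g j • y)

end Coinduced

end

/-! ### The coinduced module generates and cogenerates -/

section Main

variable {Λ : Type u} [Ring Λ] {G : Type u} [Group G] [Finite G] [MulSemiringAction G Λ]

/-- Evaluation at 1 is a Λ-linear retraction of the adjunction unit; its average is Γ-linear. -/
theorem isSummandOf_coinduced (hn : IsUnit (Nat.card G : Λ)) (Y : Type u) [AddCommGroup Y]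
    [Module Λ Y] [Module (SkewMonoidAlgebra Λ G) Y] [IsScalarTower Λ (SkewMonoidAlgebra Λ G) Y] :
    IsSummandOf (SkewMonoidAlgebra Λ G) Y (Coinduced G Y) := by
  obtain ⟨F, hF⟩ := (SkewMonoidAlgebra.hasAveraging hn).exists_linearMap (Coinduced.eval Λ G Y)
  exact ⟨Coinduced.lift LinearMap.id, F, LinearMap.ext
    (hF (Coinduced.lift LinearMap.id) LinearMap.id LinearMap.id fun y =>
      Coinduced.eval_lift LinearMap.id y)⟩

/-- The skew group algebra as a left module over the coefficients. -/
noncomputable def SkewMonoidAlgebra.linearEquivPi :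
    SkewMonoidAlgebra Λ G ≃ₗ[Λ] (G → Λ) :=
  SkewMonoidAlgebra.coeffLinearEquiv (S := Λ) ≪≫ₗ Finsupp.linearEquivFunOnFinite Λ Λ G

theorem isArtinianRing_skewMonoidAlgebra [IsArtinianRing Λ] :
    IsArtinianRing (SkewMonoidAlgebra Λ G) :=
  have : IsArtinian Λ (SkewMonoidAlgebra Λ G) :=
    isArtinian_of_linearEquiv SkewMonoidAlgebra.linearEquivPi.symm
  isArtinian_of_tower Λ this

theorem injective_skewMonoidAlgebra (hn : IsUnit (Nat.card G : Λ)) (hΛ : Module.Injective Λ Λ) :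
    Module.Injective (SkewMonoidAlgebra Λ G) (SkewMonoidAlgebra Λ G) :=
  (SkewMonoidAlgebra.hasAveraging hn).injective
    (SkewMonoidAlgebra.linearEquivPi.isSummandOf.injective inferInstance)

theorem GeneratesMod.coinduced [IsArtinianRing Λ] (hn : IsUnit (Nat.card G : Λ)) {M : Type u}
    [AddCommGroup M] [Module Λ M] (hM : GeneratesMod Λ M) :
    GeneratesMod (SkewMonoidAlgebra Λ G) (Coinduced G M) := by
  intro P hPf hPp hP
  have := isArtinianRing_skewMonoidAlgebra (Λ := Λ) (G := G)
  obtain ⟨ι, hι, Q, hQ, hΛ⟩ := exists_indecomposable_summands (R := Λ) Λ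
  obtain ⟨m, f, hf⟩ := Module.Finite.exists_fin' (SkewMonoidAlgebra Λ G) P
  obtain ⟨s, hs⟩ := Module.projective_lifting_property f LinearMap.id hf
  -- P is traced down from Γᵐ to Γ, to Λ coinduced, and to a coinduced indecomposable summand of Λ,
  -- which is a summand of M by hypothesis.
  obtain ⟨-, h1⟩ := hP.exists_isSummandOf_of_pi ⟨s, f, hs⟩
  have hΓ : IsSummandOf Λ (SkewMonoidAlgebra Λ G) (G → Λ) :=
    SkewMonoidAlgebra.linearEquivPi.isSummandOf
  obtain ⟨-, h2⟩ := hP.exists_isSummandOf_of_pi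
    ((h1.trans (isSummandOf_coinduced hn _)).trans (hΓ.coinduced_pi G))
  obtain ⟨i, h3⟩ := hP.exists_isSummandOf_of_pi (h2.trans (hΛ.coinduced_pi G))
  exact h3.trans ((hM (Q i) ((hQ i).2.finite inferInstance)
    ((hQ i).2.projective inferInstance) (hQ i).1).coinduced G)

theorem GeneratesMod.cogeneratesMod_of_injective {R : Type u} [Ring R] [IsArtinianRing R]
    (hR : Module.Injective R R) {M : Type u} [AddCommGroup M] [Module R M]
    (hM : GeneratesMod R M) : CogeneratesMod R M :=
  fun I hIf hIi hI => hM I hIf (hI.projective_of_injective hR hIi) hI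

theorem isSummandOf_coinduced_of_memAdd {M : Type u} [AddCommGroup M] [Module Λ M]
    (hadd : MemAdd Λ M (⨁ g : G, TwistedModule g M)) :
    ∃ n : ℕ, IsSummandOf Λ (Coinduced G M) (Fin n → M) := by
  classical
  have := Fintype.ofFinite G
  obtain ⟨n, hn⟩ := hadd
  refine ⟨n, IsSummandOf.trans (LinearEquiv.isSummandOf ?_) hn⟩
  exact (DirectSum.linearEquivFunOnFintype Λ G fun g => TwistedModule g M).symm

end Main

/-- The action of `G` on `Λ` by `k`-algebra automorphisms is given by `MulSemiringAction G Λ` and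
`SMulCommClass G k Λ`; `SkewMonoidAlgebra Λ G` is the skew group algebra `Λ[G]`, with
multiplication `(a g) (b h) = a g(b) gh`. -/
theorem theorem2p4 {k : Type v} [Field k] {Λ : Type u} [Ring Λ] [Algebra k Λ]
    [Module.Finite k Λ] (hΛ : Module.Injective Λ Λ)
    {G : Type u} [Group G] [Finite G] [MulSemiringAction G Λ] [SMulCommClass G k Λ]
    (hG : IsUnit (Nat.card G : k))
    (M : Type u) [AddCommGroup M] [Module Λ M] [Module.Finite Λ M]
    (hM : GeneratesMod Λ M) (hadd : MemAdd Λ M (⨁ g : G, TwistedModule g M)) :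
    repDim (SkewMonoidAlgebra Λ G) ≤ globalDim (Module.End Λ M) := by
  have hn : IsUnit (Nat.card G : Λ) := by simpa using hG.map (algebraMap k Λ)
  have : IsArtinianRing Λ := isArtinian_of_tower k inferInstance
  have := isArtinianRing_skewMonoidAlgebra (Λ := Λ) (G := G)
  obtain ⟨n, hN⟩ := isSummandOf_coinduced_of_memAdd hadd
  have : Module.Finite Λ (Coinduced G M) := hN.finite inferInstance
  have hgen : GeneratesMod (SkewMonoidAlgebra Λ G) (Coinduced G M) := hM.coinduced hn
  calc repDim (SkewMonoidAlgebra Λ G)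
      ≤ globalDim (Module.End (SkewMonoidAlgebra Λ G) (Coinduced G M)) :=
        sInf_le ⟨ModuleCat.of _ (Coinduced G M), Module.Finite.of_restrictScalars_finite Λ _ _,
          hgen, hgen.cogeneratesMod_of_injective (injective_skewMonoidAlgebra hn hΛ), rfl⟩
    _ ≤ globalDim (Module.End Λ M) :=
        (Coinduced.hasAveraging_end hn hN).globalDim_le (Coinduced.projective_end hN)
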